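/- Let $A\in\mathbb C^{n\times n}$ and let $z_1,\dots,z_N\in\mathbb C$, $N\ge 1$, be arbitrary (possibly repeated) points. Let $f$ be analytic on an open set containing the convex hull of $\sigma(A)\cup\{z_1,\dots,z_N\}$, where $\sigma(A)$ is the spectrum of $A$. Let $u,v$ be complex polynomials with $\deg u\le N-1$, with $v(z_k)\ne0$ for $k=1,\dots,N$ and $v(\lambda)\neq0$ for all $\lambda\in\sigma(A)$, and suppose that the rational function $r=u/v$ interpolates $f$ at $z_1,\dots,z_N$ counted with multiplicities: $r^{(j)}(z_k)=f^{(j)}(z_k)$ for every $k$ and every $0\le j<n_k$, where $n_k$ is the number of indices $i$ with $z_i=z_k$. Put $\Omega(z)=\prod_{k=1}^N(z-z_k)$. For a function $g$ analytic on a neighbourhood of the spectrum of a square matrix $B$ let $g(B)=\frac1{2\pi i}\int_\Gamma g(\lambda)(\lambda\mathbf 1-B)^{-1}\,d\lambda$, where $\Gamma$ is a contour enclosing the spectrum of $B$, with $g$ analytic on and inside $\Gamma$. Then for every $b\in\mathbb C^n$, with $\lVert\cdot\rVert_2$ the Euclidean norm on $\mathbb C^n$, $$\bigl\lVert (f(A)-r(A))b\bigr\rVert_2\le\max_{\substack{t\in[0,1]\\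 \mu\in\operatorname{co}\{z_1,\dots,z_N\}}}\Bigl\lVert \Omega(A)\,[v(A)]^{-1}\,\frac{(vf)^{(N)}\bigl((1-t)\mu\mathbf 1+tA\bigr)}{N!}\,b\Bigr\rVert_2 ,$$ where $\operatorname{co}$ denotes the convex hull and the maximum on the right is attained. -/

import Mathlib

/-- The contour used to evaluate an analytic function `f` at the matrix `A` is the union of the
positively oriented circles of radius `ε` about the eigenvalues of `A`. The radius is admissible
when the closed discs are pairwise disjoint and `f` is analytic on all of them. -/
def IsAdmissibleRadius {n : ℕ} (f : ℂ → ℂ) (A : Matrix (Fin n) (Fin n) ℂ) (ε : ℝ) : Prop :=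
  0 < ε ∧ (∀ a ∈ spectrum ℂ A, AnalyticOnNhd ℂ f (Metric.closedBall a ε)) ∧
    ∀ a ∈ spectrum ℂ A, ∀ c ∈ spectrum ℂ A, a ≠ c →
      Disjoint (Metric.closedBall a ε) (Metric.closedBall c ε)

/-- The Cauchy integral `(2πi)⁻¹ ∫_Γ f(z) (z 1 - A)⁻¹ dz`, computed entrywise, where `Γ` is the
union of the circles of radius `ε` about the eigenvalues of `A`. -/
noncomputable def matrixCauchyIntegral {n : ℕ} (f : ℂ → ℂ) (A : Matrix (Fin n) (Fin n) ℂ)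
    (ε : ℝ) : Matrix (Fin n) (Fin n) ℂ :=
  Matrix.of fun i j => (2 * (Real.pi : ℂ) * Complex.I)⁻¹ *
    ∑ a ∈ A.finite_spectrum.toFinset,
      ∮ z in C(a, ε), f z * ((z • (1 : Matrix (Fin n) (Fin n) ℂ) - A)⁻¹ i j)

open Classical in
/-- The analytic function `f` applied to the matrix `A`: the Cauchy integral over a contour that
encloses the spectrum of `A`. An admissible radius exists as soon as `f` is analytic on a
neighbourhood of the spectrum, and the value does not depend on it (see the two lemmas below). -/
noncomputable def matrixFun {n : ℕ} (f : ℂ → ℂ) (A : Matrix (Fin n) (Fin n) ℂ) :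
    Matrix (Fin n) (Fin n) ℂ :=
  if h : ∃ ε, IsAdmissibleRadius f A ε then matrixCauchyIntegral f A h.choose else 0

theorem exists_isAdmissibleRadius {n : ℕ} {f : ℂ → ℂ} {A : Matrix (Fin n) (Fin n) ℂ}
    (hf : ∀ a ∈ spectrum ℂ A, AnalyticAt ℂ f a) : ∃ ε, IsAdmissibleRadius f A ε := by
  have hfin : (spectrum ℂ A).Finite := A.finite_spectrum
  have h1 : ∀ a ∈ spectrum ℂ A, ∀ᶠ ε in nhdsWithin (0 : ℝ) (Set.Ioi 0),
      AnalyticOnNhd ℂ f (Metric.closedBall a ε) := by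
    intro a ha
    obtain ⟨r, hr, h⟩ := Metric.eventually_nhds_iff.1 (hf a ha).eventually_analyticAt
    filter_upwards [nhdsWithin_le_nhds (Iio_mem_nhds hr)] with ε hε z hz
    exact h (lt_of_le_of_lt hz hε)
  have h2 : ∀ a ∈ spectrum ℂ A, ∀ c ∈ spectrum ℂ A, ∀ᶠ ε in nhdsWithin (0 : ℝ) (Set.Ioi 0),
      a ≠ c → Disjoint (Metric.closedBall a ε) (Metric.closedBall c ε) := by
    intro a _ c _
    by_cases hac : a = c
    · exact Filter.Eventually.of_forall fun _ h => absurd hac h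
    · have : 0 < dist a c / 2 := half_pos (dist_pos.2 hac)
      filter_upwards [nhdsWithin_le_nhds (Iio_mem_nhds this)] with ε hε _
      have hε' : ε < dist a c / 2 := hε
      exact Metric.closedBall_disjoint_closedBall (by linarith)
  have h3 : ∀ᶠ ε in nhdsWithin (0 : ℝ) (Set.Ioi 0), IsAdmissibleRadius f A ε := by
    filter_upwards [self_mem_nhdsWithin, (Filter.eventually_all_finite hfin).2 h1,
      (Filter.eventually_all_finite hfin).2 fun a ha =>
        (Filter.eventually_all_finite hfin).2 (h2 a ha)] with ε h4 h5 h6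
    exact ⟨h4, h5, h6⟩
  exact h3.exists

theorem differentiableAt_resolvent_entry {n : ℕ} {A : Matrix (Fin n) (Fin n) ℂ} {w : ℂ}
    (hw : w ∉ spectrum ℂ A) (i j : Fin n) :
    DifferentiableAt ℂ (fun z : ℂ => (z • (1 : Matrix (Fin n) (Fin n) ℂ) - A)⁻¹ i j) w := by
  have hdet : (w • (1 : Matrix (Fin n) (Fin n) ℂ) - A).det ≠ 0 := by
    rw [spectrum.notMem_iff, Algebra.algebraMap_eq_smul_one, Matrix.isUnit_iff_isUnit_det] at hw
    exact hw.ne_zero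
  have hentry : ∀ k l : Fin n, Differentiable ℂ
      (fun z : ℂ => (z • (1 : Matrix (Fin n) (Fin n) ℂ) - A) k l) := by
    intro k l
    simp only [Matrix.sub_apply, Matrix.smul_apply, smul_eq_mul]
    fun_prop
  have hd : ∀ M : ℂ → Matrix (Fin n) (Fin n) ℂ, (∀ k l, Differentiable ℂ fun z => M z k l) →
      Differentiable ℂ fun z => (M z).det := by
    intro M hM
    simp only [Matrix.det_apply']
    fun_prop
  simp only [Matrix.inv_def, Matrix.smul_apply, Ring.inverse_eq_inv', smul_eq_mul,
    Matrix.adjugate_apply]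
  refine ((hd _ hentry w).inv hdet).mul (hd _ ?_ w)
  intro k l
  simp only [Matrix.updateRow_apply]
  split_ifs
  · fun_prop
  · exact hentry k l

theorem matrixCauchyIntegral_eq_of_le {n : ℕ} {f : ℂ → ℂ} {A : Matrix (Fin n) (Fin n) ℂ}
    {δ ε : ℝ} (hδ : 0 < δ) (hle : δ ≤ ε) (h : IsAdmissibleRadius f A ε) :
    matrixCauchyIntegral f A ε = matrixCauchyIntegral f A δ := by
  ext i j
  simp only [matrixCauchyIntegral, Matrix.of_apply]
  congr 1
  refine Finset.sum_congr rfl fun a ha => ?_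
  rw [Set.Finite.mem_toFinset] at ha
  have key : ∀ z ∈ Metric.closedBall a ε \ Metric.ball a δ, DifferentiableAt ℂ
      (fun z => f z * ((z • (1 : Matrix (Fin n) (Fin n) ℂ) - A)⁻¹ i j)) z := by
    intro z hz
    refine ((h.2.1 a ha) z hz.1).differentiableAt.mul (differentiableAt_resolvent_entry ?_ i j)
    intro hzs
    by_cases hza : a = z
    · exact hz.2 (hza ▸ Metric.mem_ball_self hδ)
    · exact Set.disjoint_left.1 (h.2.2 a ha z hzs hza) hz.1
        (Metric.mem_closedBall_self h.1.le)
  refine Complex.circleIntegral_eq_of_differentiable_on_annulus_off_countable hδ hle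
    Set.countable_empty (fun z hz => (key z hz).continuousAt.continuousWithinAt) ?_
  rintro z ⟨⟨hz1, hz2⟩, -⟩
  exact key z ⟨Metric.ball_subset_closedBall hz1,
    fun hz => hz2 (Metric.ball_subset_closedBall hz)⟩

/-- The value of `matrixFun f A` is the Cauchy integral for every admissible radius. -/
theorem matrixFun_eq {n : ℕ} {f : ℂ → ℂ} {A : Matrix (Fin n) (Fin n) ℂ} {ε : ℝ}
    (h : IsAdmissibleRadius f A ε) : matrixFun f A = matrixCauchyIntegral f A ε := by
  have hex : ∃ ε, IsAdmissibleRadius f A ε := ⟨ε, h⟩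
  rw [matrixFun, dif_pos hex]
  rcases le_total hex.choose ε with hle | hle
  · exact (matrixCauchyIntegral_eq_of_le hex.choose_spec.1 hle h).symm
  · exact matrixCauchyIntegral_eq_of_le h.1 hle hex.choose_spec

/-- The rational function `u / v` satisfies the Hermite interpolation conditions for `f` at the
points `z 0, …, z (N - 1)`, the multiplicity of a point being the number of its repetitions in
the list. -/
def Interpolates {N : ℕ} (u v : Polynomial ℂ) (f : ℂ → ℂ) (z : Fin N → ℂ) : Prop :=
  ∀ k : Fin N, ∀ j : ℕ, j < (Finset.univ.filter fun i => z i = z k).card →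
    iteratedDeriv j (fun w => u.eval w / v.eval w) (z k) = iteratedDeriv j f (z k)

/-- The nodal polynomial `Ω(w) = ∏ (w - z k)`. -/
noncomputable def nodalPoly {N : ℕ} (z : Fin N → ℂ) : Polynomial ℂ :=
  ∏ k, (Polynomial.X - Polynomial.C (z k))

/-- The Euclidean norm of a vector in `ℂⁿ`. -/
noncomputable def euclNorm {n : ℕ} (x : Fin n → ℂ) : ℝ :=
  ‖(WithLp.toLp 2 x : EuclideanSpace ℂ (Fin n))‖

/-! ### Divided differences and their derivatives -/

open Set Filter Topology

/-! Put h = v f. Near each node v f - u = v (f - r) vanishes to the order of that node's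
multiplicity, so u, having degree less than N, is the Hermite interpolant of h. Hence h - u = Ω g,
where g = h[z_1, …, z_N, ·] is the divided difference obtained by folding `dslope` over the nodes
(`sub_eval_eq_prod_mul_foldl_dslope`). Inserting A and dividing by v(A) gives f(A) - r(A) = Ω(A)
v(A)⁻¹ g(A) (`matrixFun_sub_matrixFun_eq`).

The Hermite–Genocchi formula expresses g(w) as an integral of h^(N) over a simplex of volume 1/N!,
at points (1 - t) μ + t w with μ in the convex hull of the nodes; with A in place of w it yields the
bound. The estimate is obtained without a multiple integral, by a mean value inequality for one node
at a time (`norm_jetSum_foldl_dslope_le`).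

What makes A behave like a scalar argument is the partial fraction decomposition of the resolvent:
g(A) is a finite linear combination of derivatives of g at the eigenvalues
(`IsResolventDecomposition.matrixFun_eq`). Thus differentiation in t only concerns jets at finitely
many points, and the right-hand side is continuous in (t, μ) on a compact set, so its maximum is
attained. -/

theorem AnalyticAt.dslope_analyticAt {f : ℂ → ℂ} {a x : ℂ} (ha : AnalyticAt ℂ f a)
    (hx : AnalyticAt ℂ f x) : AnalyticAt ℂ (dslope f a) x := by
  by_cases h : x = a
  · subst h
    obtain ⟨p, hp⟩ := ha
    exact ⟨_, hp.has_fpower_series_dslope_fslope⟩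
  · have h1 : AnalyticAt ℂ (fun w => (w - a)⁻¹ * (f w - f a)) x :=
      ((analyticAt_id.sub analyticAt_const).inv (sub_ne_zero.2 h)).mul (hx.sub analyticAt_const)
    refine h1.congr ((dslope_eventuallyEq_slope_of_ne f h).symm.mono fun w hw => ?_)
    rw [← hw, slope, vsub_eq_sub, smul_eq_mul]

theorem analyticOnNhd_foldl_dslope {X : Set ℂ} (l : List ℂ) {f : ℂ → ℂ}
    (hf : AnalyticOnNhd ℂ f X) (hl : ∀ a ∈ l, a ∈ X) :
    AnalyticOnNhd ℂ (l.foldl dslope f) X := by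
  induction l generalizing f with
  | nil => exact hf
  | cons a l ih =>
    exact ih (fun x hx => (hf a (hl a (by simp))).dslope_analyticAt (hf x hx))
      fun b hb => hl b (by simp [hb])

theorem foldl_dslope_zero (l : List ℂ) : l.foldl dslope (0 : ℂ → ℂ) = 0 := by
  induction l with
  | nil => rfl
  | cons a l ih =>
    have : dslope (0 : ℂ → ℂ) a = 0 := by
      ext w
      by_cases h : w = a
      · subst h; simp [Pi.zero_def]
      · simp [dslope_of_ne _ h, slope]
    rw [List.foldl_cons, this, ih]

theorem dslope_const_eq_zero (c a : ℂ) : dslope (fun _ => c) a = 0 := by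
  ext w
  by_cases h : w = a
  · subst h; simp
  · simp [dslope_of_ne _ h, slope]

/-- This cancels the factor w - a that appears when h((1 - t) a + t w) is differentiated in t. -/
theorem dslope_sub_mul_self {g : ℂ → ℂ} {a : ℂ} (hg : DifferentiableAt ℂ g a) :
    dslope (fun w => (w - a) * g w) a = g := by
  ext w
  by_cases h : w = a
  · subst h
    have : HasDerivAt (fun y => (y - w) * g y) (1 * g w + (w - w) * deriv g w) w :=
      ((hasDerivAt_id w).sub_const w).mul hg.hasDerivAt
    rw [dslope_same, this.deriv]
    ring
  · have : w - a ≠ 0 := sub_ne_zero.2 h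
    simp [dslope_of_ne _ h, slope, this]

/-- Leibniz' rule for the product with a linear factor. -/
theorem iteratedDeriv_sub_mul {d : ℂ → ℂ} {a x : ℂ} (hd : AnalyticAt ℂ d x) (k : ℕ) :
    iteratedDeriv k (fun w => (w - a) * d w) x =
      (x - a) * iteratedDeriv k d x + k * iteratedDeriv (k - 1) d x := by
  induction k generalizing d with
  | zero => simp
  | succ k ih =>
    have h1 : deriv (fun w => (w - a) * d w) =ᶠ[𝓝 x] d + fun w => (w - a) * deriv d w := by
      filter_upwards [hd.eventually_analyticAt] with y hy
      have : HasDerivAt (fun w => (w - a) * d w) (1 * d y + (y - a) * deriv d y) y :=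
        ((hasDerivAt_id y).sub_const a).mul hy.differentiableAt.hasDerivAt
      rw [this.deriv, Pi.add_apply, one_mul]
    rw [iteratedDeriv_succ', h1.iteratedDeriv_eq, iteratedDeriv_add hd.contDiffAt
      (AnalyticAt.contDiffAt (by have := hd.deriv; fun_prop)), ih hd.deriv,
      iteratedDeriv_succ']
    rcases k with _ | k
    · simp
      ring
    · simp only [Nat.add_sub_cancel, ← iteratedDeriv_succ']
      push_cast
      ring

theorem iteratedDeriv_comp_affine {g : ℂ → ℂ} {s t x : ℂ} (hg : AnalyticAt ℂ g (s + t * x))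
    (k : ℕ) : iteratedDeriv k (fun w => g (s + t * w)) x =
      t ^ k * iteratedDeriv k g (s + t * x) := by
  induction k generalizing g with
  | zero => simp
  | succ k ih =>
    have hc : ContinuousAt (fun w : ℂ => s + t * w) x := by fun_prop
    have h1 : deriv (fun w => g (s + t * w)) =ᶠ[𝓝 x] fun w => t * deriv g (s + t * w) := by
      filter_upwards [hc.eventually hg.eventually_analyticAt] with y hy
      have h2 : HasDerivAt (fun w : ℂ => s + t * w) (t * 1) y :=
        ((hasDerivAt_id y).const_mul t).const_add s
      have h3 := hy.differentiableAt.hasDerivAt.comp y h2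
      rw [show (fun w => g (s + t * w)) = g ∘ fun w => s + t * w from rfl, h3.deriv]
      ring
    rw [iteratedDeriv_succ', h1.iteratedDeriv_eq, iteratedDeriv_const_mul_field, ih hg.deriv,
      iteratedDeriv_succ']
    ring

/-- Leibniz' rule applied to f(w) = f(a) + (w - a) f[a, w]. -/
theorem iteratedDeriv_succ_eq_of_dslope {f : ℂ → ℂ} {a x : ℂ} (ha : AnalyticAt ℂ f a)
    (hx : AnalyticAt ℂ f x) (k : ℕ) :
    iteratedDeriv (k + 1) f x = (x - a) * iteratedDeriv (k + 1) (dslope f a) x +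
      (k + 1) * iteratedDeriv k (dslope f a) x := by
  have h1 : f = fun w => f a + (w - a) * dslope f a w := by
    ext w
    have := sub_smul_dslope f a w
    rw [smul_eq_mul] at this
    rw [this]
    ring
  conv_lhs => rw [h1]
  rw [iteratedDeriv_const_add (Nat.succ_pos k), iteratedDeriv_sub_mul (ha.dslope_analyticAt hx)]
  simp

/-! ### Jets depending on a parameter -/

/-- The jets of the family `g` at the points of `X` are differentiable at `τ` along `[0, 1]`,
their derivatives being the jets of `g'`. -/
def HasJetDerivAt (X : Set ℂ) (g : ℝ → ℂ → ℂ) (g' : ℂ → ℂ) (τ : ℝ) : Prop :=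
  ∀ x ∈ X, ∀ k : ℕ, HasDerivWithinAt (fun t => iteratedDeriv k (g t) x)
    (iteratedDeriv k g' x) (Icc 0 1) τ

/-- The jets of a divided difference are fixed linear expressions in the jets of the function: at a
they are f^(k+1)(a)/(k+1), and at other points they follow recursively from
`iteratedDeriv_succ_eq_of_dslope` upon division by x - a. -/
theorem HasJetDerivAt.dslope {X : Set ℂ} {g : ℝ → ℂ → ℂ} {g' : ℂ → ℂ} {τ : ℝ} {a : ℂ}
    (h : HasJetDerivAt X g g' τ) (hg : ∀ t ∈ Icc (0 : ℝ) 1, AnalyticOnNhd ℂ (g t) X)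
    (hg' : AnalyticOnNhd ℂ g' X) (hτ : τ ∈ Icc (0 : ℝ) 1) (ha : a ∈ X) :
    HasJetDerivAt X (fun t => dslope (g t) a) (dslope g' a) τ := by
  intro x hx k
  by_cases hxa : x = a
  · subst hxa
    have key : ∀ f : ℂ → ℂ, AnalyticAt ℂ f x →
        iteratedDeriv k (_root_.dslope f x) x = iteratedDeriv (k + 1) f x / ((k : ℂ) + 1) := by
      intro f hf
      have : (k : ℂ) + 1 ≠ 0 := by exact_mod_cast k.succ_ne_zero
      rw [iteratedDeriv_succ_eq_of_dslope hf hf]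
      field_simp
      ring
    rw [key g' (hg' x hx)]
    exact ((h x hx (k + 1)).div_const _).congr (fun t ht => key _ (hg t ht x hx))
      (key _ (hg τ hτ x hx))
  · have hne : x - a ≠ 0 := sub_ne_zero.2 hxa
    induction k with
    | zero =>
      have key : ∀ f : ℂ → ℂ, iteratedDeriv 0 (_root_.dslope f a) x =
          (iteratedDeriv 0 f x - iteratedDeriv 0 f a) / (x - a) := by
        intro f
        simp only [iteratedDeriv_zero]
        rw [dslope_of_ne _ hxa, slope, vsub_eq_sub, smul_eq_mul]
        field_simp
      rw [key g']
      exact (((h x hx 0).sub (h a ha 0)).div_const _).congr (fun t _ => key _) (key _)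
    | succ k ih =>
      have key : ∀ f : ℂ → ℂ, AnalyticOnNhd ℂ f X → iteratedDeriv (k + 1) (_root_.dslope f a) x =
          (iteratedDeriv (k + 1) f x - (k + 1) * iteratedDeriv k (_root_.dslope f a) x) /
            (x - a) := by
        intro f hf
        rw [iteratedDeriv_succ_eq_of_dslope (hf a ha) (hf x hx)]
        field_simp
        ring
      rw [key g' hg']
      exact (((h x hx (k + 1)).sub (ih.const_mul _)).div_const _).congr
        (fun t ht => key _ (hg t ht)) (key _ (hg τ hτ))

theorem HasJetDerivAt.foldl_dslope {X : Set ℂ} (l : List ℂ) {g : ℝ → ℂ → ℂ} {g' : ℂ → ℂ} {τ : ℝ}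
    (h : HasJetDerivAt X g g' τ) (hg : ∀ t ∈ Icc (0 : ℝ) 1, AnalyticOnNhd ℂ (g t) X)
    (hg' : AnalyticOnNhd ℂ g' X) (hτ : τ ∈ Icc (0 : ℝ) 1) (hl : ∀ a ∈ l, a ∈ X) :
    HasJetDerivAt X (fun t => l.foldl _root_.dslope (g t)) (l.foldl _root_.dslope g') τ := by
  induction l generalizing g g' with
  | nil => exact h
  | cons a l ih =>
    have ha : a ∈ X := hl a (by simp)
    exact ih (h.dslope hg hg' hτ ha)
      (fun t ht x hx => (hg t ht a ha).dslope_analyticAt (hg t ht x hx))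
      (fun x hx => (hg' a ha).dslope_analyticAt (hg' x hx)) fun b hb => hl b (by simp [hb])

/-- A function with values in a normed space that depends linearly on finitely many derivatives
of `g` at the points of a finite set. -/
noncomputable def jetSum {F : Type*} [AddCommMonoid F] [Module ℂ F] (S : Finset ℂ) (m : ℕ)
    (c : ℂ → ℕ → F) (g : ℂ → ℂ) : F :=
  ∑ a ∈ S, ∑ k ∈ Finset.range m, iteratedDeriv k g a • c a k

theorem jetSum_congr {F : Type*} [AddCommMonoid F] [Module ℂ F] {S : Finset ℂ} {m : ℕ}
    {c : ℂ → ℕ → F} {g₁ g₂ : ℂ → ℂ} (h : ∀ a ∈ S, g₁ =ᶠ[𝓝 a] g₂) :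
    jetSum S m c g₁ = jetSum S m c g₂ :=
  Finset.sum_congr rfl fun a ha => Finset.sum_congr rfl fun k _ => by
    rw [(h a ha).iteratedDeriv_eq]

theorem jetSum_const_mul {F : Type*} [AddCommMonoid F] [Module ℂ F] (S : Finset ℂ) (m : ℕ)
    (c : ℂ → ℕ → F) (r : ℂ) (g : ℂ → ℂ) :
    jetSum S m c (fun w => r * g w) = r • jetSum S m c g := by
  simp only [jetSum, Finset.smul_sum, iteratedDeriv_const_mul_field, mul_smul]

theorem jetSum_zero {F : Type*} [AddCommMonoid F] [Module ℂ F] (S : Finset ℂ) (m : ℕ)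
    (c : ℂ → ℕ → F) : jetSum S m c 0 = 0 := by
  have := jetSum_const_mul S m c 0 0
  simpa [Pi.zero_def] using this

theorem HasJetDerivAt.jetSum {F : Type*} [NormedAddCommGroup F] [NormedSpace ℂ F] {X : Set ℂ}
    {g : ℝ → ℂ → ℂ} {g' : ℂ → ℂ} {τ : ℝ} (h : HasJetDerivAt X g g' τ) {S : Finset ℂ}
    (hS : ∀ a ∈ S, a ∈ X) (m : ℕ) (c : ℂ → ℕ → F) :
    HasDerivWithinAt (fun t => jetSum S m c (g t)) (jetSum S m c g') (Icc 0 1) τ :=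
  HasDerivWithinAt.fun_sum fun a ha => HasDerivWithinAt.fun_sum fun k _ =>
    (h a (hS a ha) k).smul_const _

/-! ### The Hermite–Genocchi estimate -/

/-- A pair p encodes the affine map w ↦ p.2 + p.1 w: the vertex (1, 0) is the identity and (0, y) is
the constant y. Evaluation at x is linear in p, so only the vertices need checking. -/
theorem affine_mem_convexHull {S : Set ℂ} {l : List ℂ} {x : ℂ} (hx : x ∈ S) {p : ℝ × ℂ}
    (hp : p ∈ convexHull ℝ (insert ((1 : ℝ), (0 : ℂ)) {q : ℝ × ℂ | q.1 = 0 ∧ q.2 ∈ l})) :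
    p.2 + (p.1 : ℂ) * x ∈ convexHull ℝ (S ∪ {y | y ∈ l}) := by
  let L : ℝ × ℂ →ₗ[ℝ] ℂ :=
    LinearMap.snd ℝ ℝ ℂ + (LinearMap.fst ℝ ℝ ℂ).smulRight x
  have hL : ∀ q : ℝ × ℂ, L q = q.2 + (q.1 : ℂ) * x := fun q => by simp [L]
  have h1 : L p ∈ L '' convexHull ℝ (insert ((1 : ℝ), (0 : ℂ)) {q | q.1 = 0 ∧ q.2 ∈ l}) :=
    mem_image_of_mem L hp
  rw [L.image_convexHull, hL] at h1
  refine convexHull_mono ?_ h1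
  rintro _ ⟨q, hq | hq, rfl⟩
  · left
    rw [hL, hq]
    simpa using hx
  · right
    rw [hL, hq.1]
    simpa using hq.2

/-- Following the map encoded by p with w ↦ (1 - t) a + t w gives the convex combination of (0, a)
and p with weights 1 - t and t. -/
theorem affine_comp_mem_convexHull {l : List ℂ} {a : ℂ} {t : ℝ} (ht : t ∈ Icc (0 : ℝ) 1)
    {p : ℝ × ℂ}
    (hp : p ∈ convexHull ℝ (insert ((1 : ℝ), (0 : ℂ)) {q : ℝ × ℂ | q.1 = 0 ∧ q.2 ∈ l})) :
    ((t * p.1, (1 - (t : ℂ)) * a + t * p.2) : ℝ × ℂ) ∈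
      convexHull ℝ (insert ((1 : ℝ), (0 : ℂ)) {q : ℝ × ℂ | q.1 = 0 ∧ q.2 ∈ a :: l}) := by
  have h1 : p ∈ convexHull ℝ (insert ((1 : ℝ), (0 : ℂ)) {q : ℝ × ℂ | q.1 = 0 ∧ q.2 ∈ a :: l}) :=
    convexHull_mono (insert_subset_insert (by
      rintro q ⟨hq1, hq2⟩
      exact ⟨hq1, by simp [hq2]⟩)) hp
  have h2 : ((0, a) : ℝ × ℂ) ∈
      convexHull ℝ (insert ((1 : ℝ), (0 : ℂ)) {q : ℝ × ℂ | q.1 = 0 ∧ q.2 ∈ a :: l}) :=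
    subset_convexHull ℝ _ (Or.inr ⟨rfl, by simp⟩)
  convert! convex_convexHull ℝ _ h2 h1 (sub_nonneg.2 ht.2) ht.1 (sub_add_cancel 1 t) using 1
  ext <;> simp

/-- The Hermite–Genocchi bound for divided differences, for functions with values in a normed
space. -/
theorem norm_jetSum_foldl_dslope_le {F : Type*} [NormedAddCommGroup F] [NormedSpace ℂ F]
    (S : Finset ℂ) (m : ℕ) (c : ℂ → ℕ → F) (l : List ℂ) (h : ℂ → ℂ) (M : ℝ)
    (hh : AnalyticOnNhd ℂ h (convexHull ℝ ((S : Set ℂ) ∪ {y | y ∈ l})))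
    (hM : ∀ p ∈ convexHull ℝ (insert ((1 : ℝ), (0 : ℂ)) {q : ℝ × ℂ | q.1 = 0 ∧ q.2 ∈ l}),
      ‖jetSum S m c fun w => iteratedDeriv l.length h (p.2 + (p.1 : ℂ) * w)‖ ≤ M) :
    ‖jetSum S m c (l.foldl dslope h)‖ ≤ M / (l.length.factorial : ℝ) := by
  induction l generalizing h M with
  | nil => simpa using hM (1, 0) (subset_convexHull ℝ _ (by simp))
  | cons a l ih =>
    set X : Set ℂ := convexHull ℝ ((S : Set ℂ) ∪ {y | y ∈ a :: l}) with hX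
    have hXc : Convex ℝ X := convex_convexHull ℝ _
    have hSX : ∀ x ∈ S, x ∈ X := fun x hx => subset_convexHull ℝ _ (Or.inl hx)
    have hlX : ∀ x ∈ a :: l, x ∈ X := fun x hx => subset_convexHull ℝ _ (Or.inr hx)
    have haX : a ∈ X := hlX a (by simp)
    have hlX' : ∀ x ∈ l, x ∈ X := fun x hx => hlX x (by simp [hx])
    have hφ : ∀ t ∈ Icc (0 : ℝ) 1, ∀ x ∈ X, (1 - (t : ℂ)) * a + t * x ∈ X := by
      intro t ht x hx
      convert! hXc haX hx (sub_nonneg.2 ht.2) ht.1 (sub_add_cancel 1 t) using 1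
      simp
    have hcomp : ∀ g : ℂ → ℂ, AnalyticOnNhd ℂ g X → ∀ t ∈ Icc (0 : ℝ) 1,
        AnalyticOnNhd ℂ (fun w => g ((1 - (t : ℂ)) * a + t * w)) X := by
      intro g hg t ht x hx
      exact (hg _ (hφ t ht x hx)).fun_comp (f := fun w => (1 - (t : ℂ)) * a + t * w) (by fun_prop)
    have hjet : ∀ t ∈ Icc (0 : ℝ) 1,
        HasJetDerivAt X (fun t w => h ((1 - (t : ℂ)) * a + t * w))
          (fun w => (w - a) * deriv h ((1 - (t : ℂ)) * a + t * w)) t := by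
      intro τ hτ x hx k
      have hd : HasDerivAt (fun t : ℝ => (1 - (t : ℂ)) * a + t * x) (x - a) τ := by
        have h1 : HasDerivAt (fun t : ℝ => (t : ℂ)) 1 τ := Complex.ofRealCLM.hasDerivAt
        convert! ((h1.const_sub 1).mul_const a).add (h1.mul_const x) using 1
        ring
      have hk : HasDerivAt (iteratedDeriv k h) (iteratedDeriv (k + 1) h
          ((1 - (τ : ℂ)) * a + τ * x)) ((1 - (τ : ℂ)) * a + τ * x) := by
        rw [iteratedDeriv_succ]
        exact ((iteratedDeriv_eq_iterate (𝕜 := ℂ) (n := k) (f := h)).symm ▸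
          hh.iterated_deriv k _ (hφ τ hτ x hx)).differentiableAt.hasDerivAt
      have hp : HasDerivAt (fun t : ℝ => (t : ℂ) ^ k) (k * (τ : ℂ) ^ (k - 1)) τ := by
        simpa using (Complex.ofRealCLM.hasDerivAt (x := τ)).fun_pow k
      -- The k-th jet is t^k h^(k)((1 - t) a + t x). The two terms of its t-derivative match those
      -- of Leibniz' rule for (w - a) h'((1 - t) a + t w).
      have hprod := (hp.mul (hk.comp τ hd)).hasDerivWithinAt (s := Icc 0 1)
      have e : ∀ t ∈ Icc (0 : ℝ) 1, iteratedDeriv k (fun w => h ((1 - (t : ℂ)) * a + t * w)) x =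
          (t : ℂ) ^ k * iteratedDeriv k h ((1 - (t : ℂ)) * a + t * x) := fun t ht =>
        iteratedDeriv_comp_affine (hh _ (hφ t ht x hx)) k
      refine (hprod.congr e (e τ hτ)).congr_deriv ?_
      have hdh : AnalyticOnNhd ℂ (deriv h) X := hh.deriv
      rw [iteratedDeriv_sub_mul (hcomp _ hdh τ hτ x hx), iteratedDeriv_comp_affine
        (hdh _ (hφ τ hτ x hx)), iteratedDeriv_comp_affine (hdh _ (hφ τ hτ x hx)),
        iteratedDeriv_succ']
      rcases k with _ | k
      · simp
        ring
      · simp only [Nat.add_sub_cancel, ← iteratedDeriv_succ', Function.comp_apply]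
        ring
    -- G runs from the divided difference of a constant, at t = 0, to the one to be estimated, at t
    -- = 1. Its derivative involves (w - a) h', and the divided difference at a removes the factor w
    -- - a, so only the nodes in `l` remain.
    set G : ℝ → F := fun t =>
      jetSum S m c ((a :: l).foldl dslope fun w => h ((1 - (t : ℂ)) * a + t * w)) with hG
    set G' : ℝ → F := fun t =>
      jetSum S m c (l.foldl dslope fun w => deriv h ((1 - (t : ℂ)) * a + t * w)) with hG'
    have hder : ∀ t ∈ Icc (0 : ℝ) 1, HasDerivWithinAt G (G' t) (Icc 0 1) t := by
      intro t ht
      have han := hcomp _ hh.deriv t ht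
      have h1 := ((hjet t ht).foldl_dslope (a :: l) (hcomp h hh)
        (fun x hx => (analyticAt_id.sub analyticAt_const).mul (han x hx)) ht hlX).jetSum hSX m c
      rwa [List.foldl_cons, dslope_sub_mul_self (han a haX).differentiableAt] at h1
    have hG0 : G 0 = 0 := by
      simp only [hG, Complex.ofReal_zero, sub_zero, one_mul, zero_mul, add_zero, List.foldl_cons,
        dslope_const_eq_zero, foldl_dslope_zero, jetSum_zero]
    have hG1 : G 1 = jetSum S m c ((a :: l).foldl dslope h) := by
      simp [hG]
    -- The induction hypothesis is applied to h'((1 - t) a + t w); its `l.length` further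
    -- derivatives each contribute a factor t.
    have hbound : ∀ t ∈ Icc (0 : ℝ) 1, ‖G' t‖ ≤ M * t ^ l.length / (l.length.factorial : ℝ) := by
      intro t ht
      refine ih _ _ ((hcomp _ hh.deriv t ht).mono (convexHull_mono ?_)) ?_
      · exact union_subset_union_right _ fun y hy => by simpa using Or.inr hy
      · intro p hp
        have e : jetSum S m c (fun w => iteratedDeriv l.length
              (fun w => deriv h ((1 - (t : ℂ)) * a + t * w)) (p.2 + (p.1 : ℂ) * w)) =
            ((t : ℂ) ^ l.length) • jetSum S m c (fun w => iteratedDeriv (a :: l).length h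
              (((1 - (t : ℂ)) * a + t * p.2) + ((t * p.1 : ℝ) : ℂ) * w)) := by
          rw [← jetSum_const_mul]
          refine jetSum_congr fun x hx => ?_
          have hx' : (1 - (t : ℂ)) * a + t * (p.2 + (p.1 : ℂ) * x) ∈ X :=
            hφ t ht _ (convexHull_mono (union_subset_union_right _ fun y hy => by
              simpa using Or.inr hy) (affine_mem_convexHull (S := (S : Set ℂ)) hx hp))
          have hc : ContinuousAt (fun w : ℂ => (1 - (t : ℂ)) * a + t * (p.2 + (p.1 : ℂ) * w)) x := by
            fun_prop
          filter_upwards [hc.eventually (hh _ hx').eventually_analyticAt] with w hw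
          rw [iteratedDeriv_comp_affine hw.deriv, List.length_cons, iteratedDeriv_succ']
          congr 2
          push_cast
          ring
        rw [e, norm_smul, norm_pow, Complex.norm_real, Real.norm_of_nonneg ht.1, mul_comm]
        exact mul_le_mul_of_nonneg_right
          (hM (t * p.1, (1 - (t : ℂ)) * a + t * p.2) (affine_comp_mem_convexHull ht hp))
          (pow_nonneg ht.1 _)
    have hfac : (0 : ℝ) < l.length.factorial := by exact_mod_cast l.length.factorial_pos
    -- The primitive, vanishing at 0, of the bound for `G'`; its value at 1 is M/(l.length + 1)!.
    have hB : ∀ t : ℝ, HasDerivAt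
        (fun t => M * t ^ (l.length + 1) / ((l.length + 1).factorial : ℝ))
        (M * t ^ l.length / (l.length.factorial : ℝ)) t := by
      intro t
      convert! ((hasDerivAt_pow (l.length + 1) t).const_mul M).div_const
        ((l.length + 1).factorial : ℝ) using 1
      rw [Nat.factorial_succ]
      have : (l.length : ℝ) + 1 ≠ 0 := by positivity
      push_cast
      field_simp
    have := image_norm_le_of_norm_deriv_right_le_deriv_boundary (f := G) (f' := G') (a := 0) (b := 1)
      (fun t ht => (hder t ht).continuousWithinAt)
      (fun t ht => (hder t (Ico_subset_Icc_self ht)).mono_of_mem_nhdsWithin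
        (Icc_mem_nhdsGE_of_mem ht)) (by simp [hG0]) hB
      (fun t ht => hbound t (Ico_subset_Icc_self ht)) (right_mem_Icc.2 zero_le_one)
    simpa [hG1] using this

/-! ### The remainder of Hermite interpolation -/

/-- The remainder of Hermite interpolation is the nodal polynomial times the iterated divided
difference. -/
theorem sub_eval_eq_prod_mul_foldl_dslope (l : List ℂ) (u : Polynomial ℂ) (h : ℂ → ℂ)
    (hu : u.degree < l.length) (hh : ∀ x ∈ l, AnalyticAt ℂ h x)
    (hord : ∀ x ∈ l, (l.count x : ℕ∞) ≤ analyticOrderAt (fun w => h w - u.eval w) x) (w : ℂ) :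
    h w - u.eval w = (l.map fun a => w - a).prod * l.foldl dslope h w := by
  induction l generalizing u h with
  | nil =>
    have : u = 0 := by
      rw [← Polynomial.degree_eq_bot]
      simpa [Nat.WithBot.lt_zero_iff] using hu
    simp [this]
  | cons a l ih =>
    have ha : AnalyticAt ℂ h a := hh a (by simp)
    have hval : h a = u.eval a := by
      have h1 : (1 : ℕ∞) ≤ analyticOrderAt (fun w => h w - u.eval w) a := by
        refine le_trans ?_ (hord a (by simp))
        rw [List.count_cons_self]
        exact_mod_cast Nat.le_add_left 1 _
      have := apply_eq_zero_of_analyticOrderAt_ne_zero (Order.one_le_iff_ne_zero.1 h1)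
      exact sub_eq_zero.1 this
    obtain ⟨u₁, hu₁⟩ : (Polynomial.X - Polynomial.C a) ∣ u - Polynomial.C (u.eval a) := by
      rw [Polynomial.dvd_iff_isRoot]
      simp
    have hu₁e : ∀ y, u.eval y - u.eval a = (y - a) * u₁.eval y := fun y => by
      simpa using congrArg (Polynomial.eval y) hu₁
    have hfac : ∀ y, h y - u.eval y = (y - a) * (dslope h a y - u₁.eval y) := by
      intro y
      have := sub_smul_dslope h a y
      rw [smul_eq_mul] at this
      rw [mul_sub, this, ← hu₁e, hval]
      ring
    have hdeg : u₁.degree < l.length := by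
      by_contra! hcon
      have h1 : (u - Polynomial.C (u.eval a)).degree < (l.length + 1 : ℕ) := by
        refine (Polynomial.degree_sub_le _ _).trans_lt (max_lt (by simpa using hu) ?_)
        exact Polynomial.degree_C_le.trans_lt (by exact_mod_cast Nat.succ_pos _)
      rw [hu₁, Polynomial.degree_mul, Polynomial.degree_X_sub_C] at h1
      refine absurd h1 (not_lt.2 ?_)
      rw [add_comm l.length 1]
      push_cast
      gcongr
    rw [hfac, List.map_cons, List.prod_cons, List.foldl_cons, mul_assoc]
    congr 1
    have hhl : ∀ x ∈ l, AnalyticAt ℂ h x := fun x hx => hh x (by simp [hx])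
    refine ih u₁ (dslope h a) hdeg (fun x hx => ha.dslope_analyticAt (hhl x hx)) fun x hx => ?_
    -- Dividing h - u by w - a lowers the order at a by one and leaves it unchanged elsewhere,
    -- exactly as removing a changes the multiplicities.
    have h1 := hord x (by simp [hx])
    have hlin : AnalyticAt ℂ (fun y : ℂ => y - a) x := analyticAt_id.sub analyticAt_const
    have h2 : analyticOrderAt (fun y => h y - u.eval y) x =
        analyticOrderAt (fun y : ℂ => y - a) x +
          analyticOrderAt (fun y => dslope h a y - u₁.eval y) x := by
      rw [← analyticOrderAt_mul hlin ((ha.dslope_analyticAt (hhl x hx)).fun_sub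
        (u₁.differentiable.analyticAt x))]
      congr 1
      exact funext hfac
    rw [h2] at h1
    by_cases hxa : x = a
    · subst hxa
      have h3 : analyticOrderAt (fun y : ℂ => y - x) x = 1 :=
        hlin.analyticOrderAt_eq_one_of_zero_deriv_ne_zero (sub_self x) (by simp)
      rw [h3, List.count_cons_self, add_comm] at h1
      push_cast at h1
      exact (ENat.add_le_add_iff_left ENat.one_ne_top).1 h1
    · have h3 : analyticOrderAt (fun y : ℂ => y - a) x = 0 :=
        analyticOrderAt_eq_zero.2 (Or.inr (sub_ne_zero.2 hxa))
      rwa [h3, zero_add, List.count_cons_of_ne (Ne.symm hxa)] at h1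

/-! ### Functional calculus by partial fractions -/

/-- Data for the partial fraction decomposition of the resolvent of `B`: the matrices `Q i` sum to
the identity and are annihilated by `(B - e i) ^ m`, where the `e i` are eigenvalues of `B`. -/
structure IsResolventDecomposition {n : ℕ} {ι : Type*} (B : Matrix (Fin n) (Fin n) ℂ)
    (S : Finset ι) (e : ι → ℂ) (Q : ι → Matrix (Fin n) (Fin n) ℂ) (m : ℕ) : Prop where
  sum_eq_one : ∑ i ∈ S, Q i = 1
  pow_mul_eq_zero : ∀ i ∈ S, (B - e i • (1 : Matrix (Fin n) (Fin n) ℂ)) ^ m * Q i = 0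
  mem_spectrum : ∀ i ∈ S, e i ∈ spectrum ℂ B

/-- A telescoping geometric series; the last term vanishes once X^m Q = 0. -/
theorem smul_one_sub_mul_sum_pow {n : ℕ} (X Q : Matrix (Fin n) (Fin n) ℂ) {c : ℂ} (hc : c ≠ 0)
    (m : ℕ) : (c • (1 : Matrix (Fin n) (Fin n) ℂ) - X) *
      ∑ k ∈ Finset.range m, (1 / c ^ (k + 1)) • (X ^ k * Q) =
        Q - (1 / c ^ m) • (X ^ m * Q) := by
  induction m with
  | zero => simp
  | succ m ih =>
    rw [Finset.sum_range_succ, mul_add, ih, mul_smul_comm, sub_mul, smul_mul_assoc, one_mul,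
      ← mul_assoc, ← pow_succ', smul_sub, smul_smul]
    have : 1 / c ^ (m + 1) * c = 1 / c ^ m := by
      field_simp
      ring
    rw [this]
    abel

namespace IsResolventDecomposition

variable {n : ℕ} {ι : Type*} {B : Matrix (Fin n) (Fin n) ℂ} {S : Finset ι} {e : ι → ℂ}
  {Q : ι → Matrix (Fin n) (Fin n) ℂ} {m : ℕ}

theorem resolvent_mul_sum (D : IsResolventDecomposition B S e Q m) {z : ℂ}
    (hz : ∀ i ∈ S, z ≠ e i) :
    (z • (1 : Matrix (Fin n) (Fin n) ℂ) - B) * (∑ i ∈ S, ∑ k ∈ Finset.range m,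
      (1 / (z - e i) ^ (k + 1)) • ((B - e i • (1 : Matrix (Fin n) (Fin n) ℂ)) ^ k * Q i)) = 1 := by
  rw [Finset.mul_sum]
  refine Eq.trans ?_ D.sum_eq_one
  refine Finset.sum_congr rfl fun i hi => ?_
  have h1 : z • (1 : Matrix (Fin n) (Fin n) ℂ) - B =
      (z - e i) • (1 : Matrix (Fin n) (Fin n) ℂ) - (B - e i • 1) := by
    rw [sub_smul]
    abel
  rw [h1, smul_one_sub_mul_sum_pow _ _ (sub_ne_zero.2 (hz i hi)), D.pow_mul_eq_zero i hi]
  simp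

theorem exists_eq_of_mem_spectrum (D : IsResolventDecomposition B S e Q m) {z : ℂ}
    (hz : z ∈ spectrum ℂ B) : ∃ i ∈ S, z = e i := by
  by_contra! hcon
  refine hz ?_
  rw [spectrum.mem_resolventSet_iff, Algebra.algebraMap_eq_smul_one]
  exact IsUnit.of_mul_eq_one _ (D.resolvent_mul_sum hcon)

/-- The values of the functional calculus in terms of finitely many derivatives. -/
theorem matrixFun_eq (D : IsResolventDecomposition B S e Q m) {g : ℂ → ℂ}
    (hg : ∀ i ∈ S, AnalyticAt ℂ g (e i)) :
    matrixFun g B = ∑ i ∈ S, ∑ k ∈ Finset.range m, iteratedDeriv k g (e i) •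
      ((k.factorial : ℂ)⁻¹ • ((B - e i • (1 : Matrix (Fin n) (Fin n) ℂ)) ^ k * Q i)) := by
  classical
  obtain ⟨ε, hε⟩ := exists_isAdmissibleRadius (f := g) (A := B) fun a ha => by
    obtain ⟨i, hi, rfl⟩ := D.exists_eq_of_mem_spectrum ha
    exact hg i hi
  rw [_root_.matrixFun_eq hε]
  set X : ι → ℕ → Matrix (Fin n) (Fin n) ℂ := fun i k =>
    (B - e i • (1 : Matrix (Fin n) (Fin n) ℂ)) ^ k * Q i with hX
  ext p q
  -- Only terms with `e i = a` have their pole in the disc about a; Cauchy's formula evaluates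
  -- these, and the others integrate to zero. As `e` need not be injective, several indices may
  -- contribute.
  have hint : ∀ a ∈ spectrum ℂ B,
      (∮ z in C(a, ε), g z * ((z • (1 : Matrix (Fin n) (Fin n) ℂ) - B)⁻¹ p q)) =
      ∑ i ∈ S, ∑ k ∈ Finset.range m, if e i = a then
        2 * Real.pi * Complex.I / k.factorial * iteratedDeriv k g (e i) * X i k p q else 0 := by
    intro a ha
    have hsep : ∀ z ∈ Metric.closedBall a ε, ∀ i ∈ S, e i ≠ a → z ≠ e i := by
      rintro z hz i hi hne rfl
      exact Set.disjoint_left.1 (hε.2.2 a ha _ (D.mem_spectrum i hi) (Ne.symm hne)) hz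
        (Metric.mem_closedBall_self hε.1.le)
    have hsph : ∀ z ∈ Metric.sphere a ε, ∀ i ∈ S, z ≠ e i := by
      intro z hz i hi
      by_cases hia : e i = a
      · rw [hia]
        exact Metric.ne_of_mem_sphere hz hε.1.ne'
      · exact hsep z (Metric.sphere_subset_closedBall hz) i hi hia
    have hgd : DifferentiableOn ℂ g (Metric.closedBall a ε) := (hε.2.1 a ha).differentiableOn
    have hcongr : ∀ z ∈ Metric.sphere a ε,
        g z * ((z • (1 : Matrix (Fin n) (Fin n) ℂ) - B)⁻¹ p q) =
        ∑ i ∈ S, ∑ k ∈ Finset.range m, X i k p q * ((1 / (z - e i) ^ (k + 1)) • g z) := by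
      intro z hz
      rw [Matrix.inv_eq_right_inv (D.resolvent_mul_sum (hsph z hz))]
      simp only [Matrix.sum_apply, Matrix.smul_apply, Finset.mul_sum, smul_eq_mul]
      refine Finset.sum_congr rfl fun i _ => Finset.sum_congr rfl fun k _ => ?_
      simp only [hX]
      ring
    have hci : ∀ i ∈ S, ∀ k : ℕ, CircleIntegrable
        (fun z => X i k p q * ((1 / (z - e i) ^ (k + 1)) • g z)) a ε := by
      intro i hi k
      refine ContinuousOn.circleIntegrable hε.1.le (continuousOn_const.mul
        (ContinuousOn.smul (continuousOn_const.div (by fun_prop) fun z hz =>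
          pow_ne_zero _ (sub_ne_zero.2 (hsph z hz i hi)))
          (hgd.continuousOn.mono Metric.sphere_subset_closedBall)))
    rw [circleIntegral.integral_congr hε.1.le hcongr, circleIntegral.integral_fun_sum
      fun i hi => CircleIntegrable.fun_sum _ fun k _ => hci i hi k]
    refine Finset.sum_congr rfl fun i hi => ?_
    rw [circleIntegral.integral_fun_sum fun k _ => hci i hi k]
    refine Finset.sum_congr rfl fun k _ => ?_
    rw [circleIntegral.integral_const_mul]
    split_ifs with hia
    · rw [hia, hgd.circleIntegral_one_div_sub_center_pow_smul hε.1 k, smul_eq_mul]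
      ring
    · rw [DiffContOnCl.circleIntegral_eq_zero hε.1.le, mul_zero]
      refine DifferentiableOn.diffContOnCl ?_
      rw [closure_ball _ hε.1.ne']
      exact ((differentiableOn_const _).div (by fun_prop) fun z hz =>
        pow_ne_zero _ (sub_ne_zero.2 (hsep z hz i hi hia))).smul hgd
  rw [matrixCauchyIntegral, Matrix.of_apply, Finset.sum_congr rfl fun a ha =>
    hint a ((Set.Finite.mem_toFinset _).1 ha), Finset.sum_comm, Finset.mul_sum, Matrix.sum_apply]
  refine Finset.sum_congr rfl fun i hi => ?_
  rw [Finset.sum_comm, Finset.mul_sum, Matrix.sum_apply]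
  refine Finset.sum_congr rfl fun k _ => ?_
  rw [Finset.sum_ite_eq, if_pos ((Set.Finite.mem_toFinset _).2 (D.mem_spectrum i hi))]
  simp only [Matrix.smul_apply, smul_eq_mul, hX]
  have h2 : (Real.pi : ℂ) ≠ 0 := by exact_mod_cast Real.pi_ne_zero
  have h3 : (k.factorial : ℂ) ≠ 0 := by exact_mod_cast k.factorial_ne_zero
  field_simp [Complex.I_ne_zero]

/-- The decomposition of the resolvent of `s + t A` obtained from that of `A`. -/
theorem affine (D : IsResolventDecomposition B S e Q m) (s t : ℂ) :
    IsResolventDecomposition (s • (1 : Matrix (Fin n) (Fin n) ℂ) + t • B) S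
      (fun i => s + t * e i) Q m where
  -- The matrices `Q i` are unchanged, even for t = 0, where all the points s + t e_i coincide; this
  -- is why the indices are kept apart from the eigenvalues.
  sum_eq_one := D.sum_eq_one
  pow_mul_eq_zero i hi := by
    have h1 : s • (1 : Matrix (Fin n) (Fin n) ℂ) + t • B - (s + t * e i) • 1 =
        t • (B - e i • (1 : Matrix (Fin n) (Fin n) ℂ)) := by
      rw [add_smul, smul_sub, smul_smul]
      abel
    rw [h1, smul_pow, smul_mul_assoc, D.pow_mul_eq_zero i hi, smul_zero]
  mem_spectrum i hi := by
    intro hunit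
    refine D.mem_spectrum i hi ?_
    have h1 : (algebraMap ℂ (Matrix (Fin n) (Fin n) ℂ)) (s + t * e i) -
        (s • (1 : Matrix (Fin n) (Fin n) ℂ) + t • B) = t • ((algebraMap ℂ _) (e i) - B) := by
      simp only [Algebra.algebraMap_eq_smul_one, add_smul, smul_sub, smul_smul]
      abel
    rw [spectrum.mem_resolventSet_iff, h1] at hunit
    rw [spectrum.mem_resolventSet_iff]
    obtain ⟨Y, hY⟩ := hunit.exists_right_inv
    rw [smul_mul_assoc, ← mul_smul_comm] at hY
    exact IsUnit.of_mul_eq_one _ hY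

theorem matrixFun_affine_eq (D : IsResolventDecomposition B S e Q m) {g : ℂ → ℂ} {s t : ℂ}
    (hg : ∀ i ∈ S, AnalyticAt ℂ g (s + t * e i)) :
    matrixFun g (s • (1 : Matrix (Fin n) (Fin n) ℂ) + t • B) =
      ∑ i ∈ S, ∑ k ∈ Finset.range m, (t ^ k * iteratedDeriv k g (s + t * e i)) •
        ((k.factorial : ℂ)⁻¹ • ((B - e i • (1 : Matrix (Fin n) (Fin n) ℂ)) ^ k * Q i)) := by
  rw [(D.affine s t).matrixFun_eq hg]
  refine Finset.sum_congr rfl fun i _ => Finset.sum_congr rfl fun k _ => ?_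
  have h1 : s • (1 : Matrix (Fin n) (Fin n) ℂ) + t • B - (s + t * e i) • 1 =
      t • (B - e i • (1 : Matrix (Fin n) (Fin n) ℂ)) := by
    rw [add_smul, smul_sub, smul_smul]
    abel
  rw [h1, smul_pow, smul_mul_assoc]
  simp only [smul_smul]
  congr 1
  ring

theorem matrixFun_comp_affine (D : IsResolventDecomposition B S e Q m) {g : ℂ → ℂ} {s t : ℂ}
    (hg : ∀ i ∈ S, AnalyticAt ℂ g (s + t * e i)) :
    matrixFun (fun w => g (s + t * w)) B =
      matrixFun g (s • (1 : Matrix (Fin n) (Fin n) ℂ) + t • B) := by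
  rw [D.matrixFun_affine_eq hg, D.matrixFun_eq fun i hi =>
    (hg i hi).fun_comp (f := fun w => s + t * w) (by fun_prop)]
  exact Finset.sum_congr rfl fun i hi => Finset.sum_congr rfl fun k _ => by
    rw [iteratedDeriv_comp_affine (hg i hi)]

theorem matrixFun_congr (D : IsResolventDecomposition B S e Q m) {f g : ℂ → ℂ}
    (hg : ∀ i ∈ S, AnalyticAt ℂ g (e i)) (hfg : ∀ i ∈ S, f =ᶠ[𝓝 (e i)] g) :
    matrixFun f B = matrixFun g B := by
  rw [D.matrixFun_eq hg, D.matrixFun_eq fun i hi => (hg i hi).congr (hfg i hi).symm]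
  exact Finset.sum_congr rfl fun i hi => Finset.sum_congr rfl fun k _ => by
    rw [(hfg i hi).iteratedDeriv_eq]

theorem matrixFun_add (D : IsResolventDecomposition B S e Q m) {f g : ℂ → ℂ}
    (hf : ∀ i ∈ S, AnalyticAt ℂ f (e i)) (hg : ∀ i ∈ S, AnalyticAt ℂ g (e i)) :
    matrixFun (fun w => f w + g w) B = matrixFun f B + matrixFun g B := by
  rw [D.matrixFun_eq fun i hi => (hf i hi).fun_add (hg i hi), D.matrixFun_eq hf,
    D.matrixFun_eq hg]
  simp only [← Finset.sum_add_distrib, ← add_smul]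
  exact Finset.sum_congr rfl fun i hi => Finset.sum_congr rfl fun k _ => by
    rw [iteratedDeriv_fun_add (hf i hi).contDiffAt (hg i hi).contDiffAt]

theorem matrixFun_const_mul (D : IsResolventDecomposition B S e Q m) {g : ℂ → ℂ} (c : ℂ)
    (hg : ∀ i ∈ S, AnalyticAt ℂ g (e i)) :
    matrixFun (fun w => c * g w) B = c • matrixFun g B := by
  rw [D.matrixFun_eq fun i hi => analyticAt_const.fun_mul (hg i hi), D.matrixFun_eq hg]
  simp only [Finset.smul_sum, iteratedDeriv_const_mul_field, mul_smul]

theorem matrixFun_id_mul (D : IsResolventDecomposition B S e Q m) {g : ℂ → ℂ}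
    (hg : ∀ i ∈ S, AnalyticAt ℂ g (e i)) :
    matrixFun (fun w => w * g w) B = B * matrixFun g B := by
  rw [D.matrixFun_eq fun i hi => (show AnalyticAt ℂ (fun w => w) (e i) from analyticAt_id).fun_mul
    (hg i hi), D.matrixFun_eq hg,
    Finset.mul_sum]
  refine Finset.sum_congr rfl fun i hi => ?_
  set X := B - e i • (1 : Matrix (Fin n) (Fin n) ℂ) with hX
  -- Leibniz' rule makes the truncated sums agree up to one boundary term, with X^(j+1) Q, which is
  -- zero when j + 1 = m.
  have key : ∀ j : ℕ, ∑ k ∈ Finset.range (j + 1), iteratedDeriv k (fun w => w * g w) (e i) •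
      ((k.factorial : ℂ)⁻¹ • (X ^ k * Q i)) =
        B * ∑ k ∈ Finset.range (j + 1), iteratedDeriv k g (e i) •
          ((k.factorial : ℂ)⁻¹ • (X ^ k * Q i)) -
          iteratedDeriv j g (e i) • ((j.factorial : ℂ)⁻¹ • (X ^ (j + 1) * Q i)) := by
    have hB : B = e i • (1 : Matrix (Fin n) (Fin n) ℂ) + X := by
      rw [hX]
      abel
    have hL : ∀ k : ℕ, iteratedDeriv k (fun w => w * g w) (e i) =
        e i * iteratedDeriv k g (e i) + k * iteratedDeriv (k - 1) g (e i) := fun k => by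
      simpa using iteratedDeriv_sub_mul (a := 0) (hg i hi) k
    have hBX : ∀ k : ℕ, B * (X ^ k * Q i) = e i • (X ^ k * Q i) + X ^ (k + 1) * Q i := by
      intro k
      rw [pow_succ', mul_assoc]
      nth_rewrite 1 [hB]
      rw [add_mul, smul_mul_assoc, one_mul]
    intro j
    induction j with
    | zero =>
      have h0 := hBX 0
      rw [pow_zero, one_mul, zero_add, pow_one] at h0
      simp [h0, smul_smul, mul_comm]
    | succ j ih =>
      rw [Finset.sum_range_succ, ih, Finset.sum_range_succ _ (j + 1), mul_add, hL,
        mul_smul_comm, mul_smul_comm, hBX (j + 1)]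
      have hj : ((j + 1).factorial : ℂ)⁻¹ * ((j : ℂ) + 1) = (j.factorial : ℂ)⁻¹ := by
        have h1 : (j : ℂ) + 1 ≠ 0 := by exact_mod_cast j.succ_ne_zero
        rw [Nat.factorial_succ]
        push_cast
        field_simp
      rw [← hj]
      simp only [Nat.add_sub_cancel, Nat.cast_add, Nat.cast_one]
      module
  rcases m with _ | j
  · simp
  · rw [key j, D.pow_mul_eq_zero i hi]
    simp

theorem matrixFun_eval_mul (D : IsResolventDecomposition B S e Q m) (v : Polynomial ℂ)
    {g : ℂ → ℂ} (hg : ∀ i ∈ S, AnalyticAt ℂ g (e i)) :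
    matrixFun (fun w => v.eval w * g w) B = Polynomial.aeval B v * matrixFun g B := by
  induction v using Polynomial.induction_on' with
  | add p q hp hq =>
    have hpq : ∀ r : Polynomial ℂ, ∀ i ∈ S, AnalyticAt ℂ (fun w => r.eval w * g w) (e i) :=
      fun r i hi => (r.differentiable.analyticAt _).fun_mul (hg i hi)
    simp only [Polynomial.eval_add, add_mul, map_add]
    rw [D.matrixFun_add (hpq p) (hpq q), hp, hq]
  | monomial k a =>
    have han : ∀ k : ℕ, ∀ i ∈ S, AnalyticAt ℂ (fun w => w ^ k * g w) (e i) := fun k i hi =>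
      (analyticAt_id.pow k).fun_mul (hg i hi)
    have hk : ∀ k : ℕ, matrixFun (fun w => w ^ k * g w) B = B ^ k * matrixFun g B := by
      intro k
      induction k with
      | zero => simp
      | succ k ih =>
        simp only [pow_succ', mul_assoc]
        rw [D.matrixFun_id_mul (han k), ih]
    simp only [Polynomial.eval_monomial, Polynomial.aeval_monomial, mul_assoc]
    rw [D.matrixFun_const_mul a (han k), hk,
      Algebra.algebraMap_eq_smul_one, smul_mul_assoc, one_mul]

theorem matrixFun_one (D : IsResolventDecomposition B S e Q m) (hm : 0 < m) :
    matrixFun (fun _ => 1) B = 1 := by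
  rw [D.matrixFun_eq fun _ _ => analyticAt_const, ← D.sum_eq_one]
  refine Finset.sum_congr rfl fun i _ => ?_
  rw [Finset.sum_eq_single_of_mem 0 (Finset.mem_range.2 hm)]
  · simp
  · intro k _ hk
    simp [iteratedDeriv_const, hk]

theorem matrixFun_eval (D : IsResolventDecomposition B S e Q m) (hm : 0 < m)
    (v : Polynomial ℂ) : matrixFun (fun w => v.eval w) B = Polynomial.aeval B v := by
  have := D.matrixFun_eval_mul v (g := fun _ => 1) fun _ _ => analyticAt_const
  simpa [D.matrixFun_one hm] using this

end IsResolventDecomposition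

/-! ### Existence of the decomposition -/

/-- The powers (X - a)^m are pairwise coprime, so Bézout gives 1 as a sum of multiples of the
complementary products. Each summand, evaluated at A, is killed by (A - a)^m because the full
product is a multiple of the characteristic polynomial (Cayley–Hamilton). -/
theorem exists_isResolventDecomposition {n : ℕ} (A : Matrix (Fin n) (Fin n) ℂ) :
    ∃ (Q : ℂ → Matrix (Fin n) (Fin n) ℂ) (m : ℕ), 0 < m ∧
      IsResolventDecomposition A A.finite_spectrum.toFinset id Q m := by
  classical
  set S := A.finite_spectrum.toFinset with hS
  have hmem : ∀ {a}, a ∈ S ↔ a ∈ spectrum ℂ A := Set.Finite.mem_toFinset _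
  rcases Nat.eq_zero_or_pos n with rfl | hn
  · exact ⟨0, 1, one_pos, Subsingleton.elim _ _, fun _ _ => Subsingleton.elim _ _,
      fun i hi => hmem.1 hi⟩
  have : Nonempty (Fin n) := ⟨⟨0, hn⟩⟩
  have hne : S.Nonempty := by
    obtain ⟨a, ha⟩ := spectrum.nonempty_of_isAlgClosed_of_finiteDimensional ℂ A
    exact ⟨a, hmem.2 ha⟩
  -- The number of roots bounds every multiplicity; the extra 1 makes m positive, so that the sums
  -- include the term k = 0.
  set m := Multiset.card A.charpoly.roots + 1 with hm
  set P : ℂ → Polynomial ℂ := fun a => (Polynomial.X - Polynomial.C a) ^ m with hP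
  have hcop : Pairwise (Function.onFun IsCoprime fun i : S => P i) := fun i j hij =>
    (Polynomial.isCoprime_X_sub_C_of_isUnit_sub
      (sub_ne_zero.2 fun h => hij (Subtype.ext h)).isUnit).pow
  obtain ⟨μ, hμ⟩ := (exists_sum_eq_one_iff_pairwise_coprime hne).2 hcop
  have hroots : ∀ a, a ∈ A.charpoly.roots → a ∈ S := fun a ha => by
    rw [hmem, Matrix.mem_spectrum_iff_isRoot_charpoly]
    exact Polynomial.isRoot_of_mem_roots ha
  have hdvd : A.charpoly ∣ ∏ a ∈ S, P a := by
    have h1 := (IsAlgClosed.splits A.charpoly).eq_prod_roots_of_monic A.charpoly_monic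
    rw [h1, Finset.prod_multiset_map_count]
    refine (Finset.prod_dvd_prod_of_dvd _ _ fun a _ => ?_).trans
      (Finset.prod_dvd_prod_of_subset _ _ _ fun a ha => hroots a (Multiset.mem_toFinset.1 ha))
    exact pow_dvd_pow _ ((Multiset.count_le_card _ _).trans (Nat.le_succ _))
  have hzero : Polynomial.aeval A (∏ a ∈ S, P a) = 0 := by
    obtain ⟨r, hr⟩ := hdvd
    rw [hr, map_mul, Matrix.aeval_self_charpoly, zero_mul]
  refine ⟨fun a => Polynomial.aeval A (μ a * ∏ c ∈ S \ {a}, P c), m, Nat.succ_pos _, ?_, ?_,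
    fun i hi => hmem.1 hi⟩
  · rw [← map_sum, hμ, map_one]
  · intro a ha
    have h1 : (A - id a • (1 : Matrix (Fin n) (Fin n) ℂ)) ^ m = Polynomial.aeval A (P a) := by
      simp [hP, Algebra.algebraMap_eq_smul_one]
    have h2 : P a * (μ a * ∏ c ∈ S \ {a}, P c) = μ a * ∏ c ∈ S, P c := by
      rw [← Finset.prod_sdiff (Finset.singleton_subset_iff.2 ha), Finset.prod_singleton]
      ring
    rw [h1, ← map_mul, h2, map_mul, hzero, mul_zero]

/-! ### The interpolation error and the final bound -/

/-- The hull is the union of the segments from (1, 0) to points (0, μ), and `p.1` is the position on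
the segment. This turns the affine maps of the Hermite–Genocchi estimate into w ↦ (1 - t) μ + t w.
-/
theorem exists_eq_of_mem_convexHull_insert {R : Set ℂ} (hR : R.Nonempty) {p : ℝ × ℂ}
    (hp : p ∈ convexHull ℝ (insert ((1 : ℝ), (0 : ℂ)) {q : ℝ × ℂ | q.1 = 0 ∧ q.2 ∈ R})) :
    p.1 ∈ Icc (0 : ℝ) 1 ∧ ∃ μ ∈ convexHull ℝ R, p.2 = (1 - (p.1 : ℂ)) * μ := by
  have h1 : {q : ℝ × ℂ | q.1 = 0 ∧ q.2 ∈ R} = {0} ×ˢ R := by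
    ext q
    simp
  rw [h1, convexHull_insert ((singleton_nonempty _).prod hR), convexHull_prod,
    convexHull_singleton, mem_convexJoin] at hp
  obtain ⟨_, rfl, y, ⟨hy1, hy2⟩, α, β, hα, hβ, hαβ, rfl⟩ := hp
  rw [mem_singleton_iff] at hy1
  have hβ' : β = 1 - α := by linarith
  refine ⟨by simpa [hy1] using ⟨hα, by linarith⟩, y.2, hy2, ?_⟩
  simp [hy1, hβ']

theorem count_ofFn_eq_card_filter {N : ℕ} (z : Fin N → ℂ) (x : ℂ) :
    (List.ofFn z).count x = (Finset.univ.filter fun i => z i = x).card := by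
  induction N with
  | zero => simp
  | succ N ih =>
    rw [List.ofFn_succ, List.count_cons, ih, Finset.card_filter, Finset.card_filter,
      Fin.sum_univ_succ, add_comm]
    simp

theorem eval_nodalPoly {N : ℕ} (z : Fin N → ℂ) (w : ℂ) :
    (nodalPoly z).eval w = ((List.ofFn z).map fun a => w - a).prod := by
  simp [nodalPoly, Polynomial.eval_prod, List.map_ofFn, List.prod_ofFn]

theorem Interpolates.count_le_analyticOrderAt {N : ℕ} {u v : Polynomial ℂ} {f : ℂ → ℂ}
    {z : Fin N → ℂ} (hint : Interpolates u v f z) (hf : ∀ k, AnalyticAt ℂ f (z k))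
    (hv : ∀ k, v.eval (z k) ≠ 0) (k : Fin N) :
    ((List.ofFn z).count (z k) : ℕ∞) ≤
      analyticOrderAt (fun w => v.eval w * f w - u.eval w) (z k) := by
  have hva : AnalyticAt ℂ (fun w => v.eval w) (z k) := v.differentiable.analyticAt _
  have hr : AnalyticAt ℂ (fun w => u.eval w / v.eval w) (z k) :=
    (u.differentiable.analyticAt _).fun_div hva (hv k)
  have hfr := (hf k).fun_sub hr
  have h1 : ((List.ofFn z).count (z k) : ℕ∞) ≤
      analyticOrderAt (fun w => f w - u.eval w / v.eval w) (z k) := by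
    rw [natCast_le_analyticOrderAt_iff_iteratedDeriv_eq_zero hfr]
    intro j hj
    rw [count_ofFn_eq_card_filter] at hj
    rw [iteratedDeriv_fun_sub (hf k).contDiffAt hr.contDiffAt, hint k j hj, sub_self]
  have h2 : (fun w => v.eval w * f w - u.eval w) =ᶠ[𝓝 (z k)]
      (fun w => v.eval w) * fun w => f w - u.eval w / v.eval w := by
    filter_upwards [hva.continuousAt.eventually_ne (hv k)] with w hw
    rw [Pi.mul_apply, mul_sub, mul_div_cancel₀ _ hw]
  rw [analyticOrderAt_congr h2, analyticOrderAt_mul hva hfr]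
  exact h1.trans le_add_self

/-- The calculus turns v · (1/v) = 1, valid near the spectrum, into a right inverse of v(A). -/
theorem aeval_mul_inv_cancel {n : ℕ} {A : Matrix (Fin n) (Fin n) ℂ} {v : Polynomial ℂ}
    (hv : ∀ a ∈ spectrum ℂ A, v.eval a ≠ 0) :
    Polynomial.aeval A v * (Polynomial.aeval A v)⁻¹ = 1 := by
  obtain ⟨Q, m, hm, D⟩ := exists_isResolventDecomposition A
  have hS : ∀ a ∈ A.finite_spectrum.toFinset, v.eval (id a) ≠ 0 := fun a ha =>
    hv a ((Set.Finite.mem_toFinset _).1 ha)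
  have hva : ∀ a, AnalyticAt ℂ (fun w => v.eval w) a := fun a => v.differentiable.analyticAt _
  have h1 := D.matrixFun_eval_mul v (g := fun w => (v.eval w)⁻¹) fun a ha =>
    (hva _).fun_inv (hS a ha)
  rw [D.matrixFun_congr (g := fun _ => 1) (fun _ _ => analyticAt_const) fun a ha => ?_,
    D.matrixFun_one hm] at h1
  · rw [Matrix.inv_eq_right_inv h1.symm]
    exact h1.symm
  · filter_upwards [(hva _).continuousAt.eventually_ne (hS a ha)] with w hw
    exact mul_inv_cancel₀ hw

/-- The error of rational Hermite interpolation of a matrix function. -/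
theorem matrixFun_sub_matrixFun_eq {n N : ℕ} (A : Matrix (Fin n) (Fin n) ℂ) (z : Fin N → ℂ)
    (f : ℂ → ℂ) (hfA : ∀ a ∈ spectrum ℂ A, AnalyticAt ℂ f a) (hfz : ∀ k, AnalyticAt ℂ f (z k))
    (u v : Polynomial ℂ) (hu : u.degree < N) (hvz : ∀ k, v.eval (z k) ≠ 0)
    (hvA : ∀ a ∈ spectrum ℂ A, v.eval a ≠ 0) (hint : Interpolates u v f z) :
    matrixFun f A - matrixFun (fun w => u.eval w / v.eval w) A =
      Polynomial.aeval A (nodalPoly z) * (Polynomial.aeval A v)⁻¹ *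
        matrixFun ((List.ofFn z).foldl dslope fun w => v.eval w * f w) A := by
  obtain ⟨Q, m, hm, D⟩ := exists_isResolventDecomposition A
  set h : ℂ → ℂ := fun w => v.eval w * f w with hh
  set g := (List.ofFn z).foldl dslope h with hg
  have hpol : ∀ (p : Polynomial ℂ) (a : ℂ), AnalyticAt ℂ (fun w => p.eval w) a :=
    fun p a => p.differentiable.analyticAt _
  have hS : ∀ {a}, a ∈ A.finite_spectrum.toFinset → a ∈ spectrum ℂ A := fun ha =>
    (Set.Finite.mem_toFinset _).1 ha
  have hX : AnalyticOnNhd ℂ h (spectrum ℂ A ∪ Set.range z) := by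
    rintro x (hx | ⟨k, rfl⟩)
    · exact (hpol v x).fun_mul (hfA x hx)
    · exact (hpol v _).fun_mul (hfz k)
  have hgan : AnalyticOnNhd ℂ g (spectrum ℂ A ∪ Set.range z) :=
    analyticOnNhd_foldl_dslope _ hX fun a ha => Or.inr (by simpa [List.mem_ofFn] using ha)
  have hid : h = fun w => u.eval w + (nodalPoly z).eval w * g w := by
    ext w
    have := sub_eval_eq_prod_mul_foldl_dslope (List.ofFn z) u h (by simpa using hu)
      (fun x hx => hX x (Or.inr (by simpa [List.mem_ofFn] using hx))) (fun x hx => by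
        obtain ⟨k, rfl⟩ : ∃ k, z k = x := by simpa [List.mem_ofFn] using hx
        exact hint.count_le_analyticOrderAt hfz hvz k) w
    rw [eval_nodalPoly, ← this]
    ring
  -- Evaluating h at A in two ways gives v(A) f(A) = u(A) + Ω(A) g(A), where u(A) = v(A) r(A).
  have h1 : matrixFun h A = Polynomial.aeval A v * matrixFun f A :=
    D.matrixFun_eval_mul v fun a ha => hfA a (hS ha)
  have h2 : matrixFun h A = Polynomial.aeval A u +
      Polynomial.aeval A (nodalPoly z) * matrixFun g A := by
    have hgS : ∀ a ∈ A.finite_spectrum.toFinset, AnalyticAt ℂ g (id a) := fun a ha =>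
      hgan a (Or.inl (hS ha))
    conv_lhs => rw [hid]
    rw [D.matrixFun_add (fun a _ => hpol u _) fun a ha => (hpol _ _).fun_mul (hgS a ha),
      D.matrixFun_eval hm, D.matrixFun_eval_mul _ hgS]
  have h3 : Polynomial.aeval A u =
      Polynomial.aeval A v * matrixFun (fun w => u.eval w / v.eval w) A := by
    rw [← D.matrixFun_eval_mul v fun a ha => (hpol u _).fun_div (hpol v _) (hvA _ (hS ha)),
      ← D.matrixFun_eval hm]
    refine (D.matrixFun_congr (fun a _ => hpol u _) fun a ha => ?_).symm
    filter_upwards [(hpol v _).continuousAt.eventually_ne (hvA _ (hS ha))] with w hw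
    exact mul_div_cancel₀ _ hw
  have hinv := aeval_mul_inv_cancel hvA
  have hinv' : (Polynomial.aeval A v)⁻¹ * Polynomial.aeval A v = 1 := mul_eq_one_comm.1 hinv
  have hcomm : Polynomial.aeval A (nodalPoly z) * (Polynomial.aeval A v)⁻¹ =
      (Polynomial.aeval A v)⁻¹ * Polynomial.aeval A (nodalPoly z) := by
    have h4 : Polynomial.aeval A v * Polynomial.aeval A (nodalPoly z) =
        Polynomial.aeval A (nodalPoly z) * Polynomial.aeval A v := by
      rw [← map_mul, ← map_mul, mul_comm]
    calc _ = (Polynomial.aeval A v)⁻¹ * (Polynomial.aeval A v * Polynomial.aeval A (nodalPoly z)) *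
          (Polynomial.aeval A v)⁻¹ := by rw [← mul_assoc, hinv', one_mul]
      _ = _ := by rw [h4, ← mul_assoc, mul_assoc, hinv, mul_one]
  rw [h1, h3, ← sub_eq_iff_eq_add', ← mul_sub] at h2
  rw [hcomm, mul_assoc, ← h2, ← mul_assoc, hinv', one_mul]

/-- The linear map `X ↦ C X b` with values in the Euclidean space. -/
noncomputable def mulVecEuclidean {n : ℕ} (C : Matrix (Fin n) (Fin n) ℂ) (b : Fin n → ℂ) :
    Matrix (Fin n) (Fin n) ℂ →ₗ[ℂ] EuclideanSpace ℂ (Fin n) where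
  toFun X := WithLp.toLp 2 ((C * X).mulVec b)
  map_add' X Y := by rw [mul_add, Matrix.add_mulVec, WithLp.toLp_add]
  map_smul' r X := by rw [mul_smul_comm, Matrix.smul_mulVec, WithLp.toLp_smul, RingHom.id_apply]

theorem corollaryc {n N : ℕ} (hN : 0 < N) (A : Matrix (Fin n) (Fin n) ℂ) (z : Fin N → ℂ)
    (f : ℂ → ℂ) (U : Set ℂ) (hU : IsOpen U)
    (hsub : convexHull ℝ (spectrum ℂ A ∪ Set.range z) ⊆ U) (hf : AnalyticOnNhd ℂ f U)
    (u v : Polynomial ℂ) (hu : u.natDegree ≤ N - 1)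
    (hvz : ∀ k, v.eval (z k) ≠ 0) (hvA : ∀ a ∈ spectrum ℂ A, v.eval a ≠ 0)
    (hint : Interpolates u v f z) (b : Fin n → ℂ) :
    ∃ M : ℝ,
      IsGreatest
        {x : ℝ | ∃ t ∈ Set.Icc (0 : ℝ) 1, ∃ μ ∈ convexHull ℝ (Set.range z),
          x = euclNorm
            ((Polynomial.aeval A (nodalPoly z) * (Polynomial.aeval A v)⁻¹ *
              ((Nat.factorial N : ℂ)⁻¹ •
                matrixFun (iteratedDeriv N (fun w => v.eval w * f w))
                  (((1 - (t : ℂ)) * μ) • (1 : Matrix (Fin n) (Fin n) ℂ) + (t : ℂ) • A))).mulVec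
              b)} M ∧
      euclNorm ((matrixFun f A - matrixFun (fun w => u.eval w / v.eval w) A).mulVec b) ≤ M := by
  obtain ⟨Q, m, hm, D⟩ := exists_isResolventDecomposition A
  set S := A.finite_spectrum.toFinset with hSdef
  set K := convexHull ℝ (spectrum ℂ A ∪ Set.range z) with hK
  set h : ℂ → ℂ := fun w => v.eval w * f w with hh
  have hSK : ∀ a ∈ S, a ∈ K := fun a ha =>
    subset_convexHull ℝ _ (Or.inl ((Set.Finite.mem_toFinset _).1 ha))
  have hzK : ∀ k, z k ∈ K := fun k => subset_convexHull ℝ _ (Or.inr ⟨k, rfl⟩)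
  have hfK : AnalyticOnNhd ℂ f K := hf.mono hsub
  have hhK : AnalyticOnNhd ℂ h K := fun x hx =>
    (v.differentiable.analyticAt x).fun_mul (hfK x hx)
  have hdK : ∀ k, AnalyticOnNhd ℂ (iteratedDeriv k h) K := fun k => by
    rw [iteratedDeriv_eq_iterate]
    exact hhK.iterated_deriv k
  have hmem : ∀ t ∈ Set.Icc (0 : ℝ) 1, ∀ μ ∈ convexHull ℝ (Set.range z), ∀ a ∈ S,
      (1 - (t : ℂ)) * μ + t * a ∈ K := by
    intro t ht μ hμ a ha
    convert! convex_convexHull ℝ _ (convexHull_mono subset_union_right hμ) (hSK a ha)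
      (sub_nonneg.2 ht.2) ht.1 (sub_add_cancel 1 t) using 1
    simp
  -- Absorbing Ω(A) v(A)⁻¹ and b into the coefficients lets the estimate act on the vector itself,
  -- with no separate operator norms.
  set L := mulVecEuclidean (Polynomial.aeval A (nodalPoly z) * (Polynomial.aeval A v)⁻¹) b with hL
  set c : ℂ → ℕ → EuclideanSpace ℂ (Fin n) := fun a k => L ((k.factorial : ℂ)⁻¹ •
    ((A - a • (1 : Matrix (Fin n) (Fin n) ℂ)) ^ k * Q a)) with hc
  have hLjet : ∀ g : ℂ → ℂ, (∀ a ∈ S, AnalyticAt ℂ g a) →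
      L (matrixFun g A) = jetSum S m c g := by
    intro g hg
    rw [D.matrixFun_eq hg]
    simp only [map_sum, map_smul, jetSum, hc, id]
  set Φ : ℝ × ℂ → ℝ := fun p => ‖(N.factorial : ℂ)⁻¹ • L (matrixFun (iteratedDeriv N h)
    (((1 - (p.1 : ℂ)) * p.2) • (1 : Matrix (Fin n) (Fin n) ℂ) + (p.1 : ℂ) • A))‖ with hΦ
  have hΦe : ∀ t μ, Φ (t, μ) = euclNorm
      ((Polynomial.aeval A (nodalPoly z) * (Polynomial.aeval A v)⁻¹ *
        ((Nat.factorial N : ℂ)⁻¹ • matrixFun (iteratedDeriv N h)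
          (((1 - (t : ℂ)) * μ) • (1 : Matrix (Fin n) (Fin n) ℂ) + (t : ℂ) • A))).mulVec b) := by
    intro t μ
    simp only [hΦ]
    rw [← map_smul]
    rfl
  -- All the matrices (1 - t) μ 1 + t A share one decomposition, so the expression is a finite sum
  -- of derivatives of h at points moving continuously in the hull.
  have hcont : ContinuousOn Φ (Set.Icc (0 : ℝ) 1 ×ˢ convexHull ℝ (Set.range z)) := by
    refine ContinuousOn.norm (ContinuousOn.const_smul (g := fun p : ℝ × ℂ =>
      L (matrixFun (iteratedDeriv N h) (((1 - (p.1 : ℂ)) * p.2) •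
        (1 : Matrix (Fin n) (Fin n) ℂ) + (p.1 : ℂ) • A))) ?_ ((N.factorial : ℂ)⁻¹))
    have e : ∀ p ∈ Set.Icc (0 : ℝ) 1 ×ˢ convexHull ℝ (Set.range z),
        L (matrixFun (iteratedDeriv N h)
          (((1 - (p.1 : ℂ)) * p.2) • (1 : Matrix (Fin n) (Fin n) ℂ) + (p.1 : ℂ) • A)) =
        ∑ a ∈ S, ∑ k ∈ Finset.range m, ((p.1 : ℂ) ^ k * iteratedDeriv k (iteratedDeriv N h)
          ((1 - (p.1 : ℂ)) * p.2 + p.1 * a)) • c a k := by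
      intro p hp
      rw [D.matrixFun_affine_eq fun a ha => hdK N _ (hmem _ hp.1 _ hp.2 a ha)]
      simp only [map_sum, map_smul, hc, id]
    refine ContinuousOn.congr ?_ e
    refine continuousOn_finsetSum _ fun a ha => continuousOn_finsetSum _ fun k _ =>
      ContinuousOn.fun_smul (ContinuousOn.fun_mul (Continuous.continuousOn ?_) ?_) continuousOn_const
    · fun_prop
    have hd : ContinuousOn (iteratedDeriv k (iteratedDeriv N h)) K := by
      rw [iteratedDeriv_eq_iterate]
      exact ((hdK N).iterated_deriv k).continuousOn
    exact hd.comp (f := fun p : ℝ × ℂ => (1 - (p.1 : ℂ)) * p.2 + p.1 * a) (by fun_prop)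
      fun p hp => hmem _ hp.1 _ hp.2 a ha
  have hcomp : IsCompact (Set.Icc (0 : ℝ) 1 ×ˢ convexHull ℝ (Set.range z)) :=
    isCompact_Icc.prod ((Set.finite_range z).isCompact_convexHull ℝ)
  have hRne : (Set.range z).Nonempty := ⟨z ⟨0, hN⟩, _, rfl⟩
  obtain ⟨⟨t₀, μ₀⟩, ⟨ht₀, hμ₀⟩, hmax⟩ := hcomp.exists_isMaxOn
    ((Set.nonempty_Icc.2 zero_le_one).prod hRne.convexHull) hcont
  refine ⟨Φ (t₀, μ₀), ⟨⟨t₀, ht₀, μ₀, hμ₀, hΦe _ _⟩, ?_⟩, ?_⟩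
  · rintro _ ⟨t, ht, μ, hμ, rfl⟩
    rw [← hΦe]
    exact hmax (show (t, μ) ∈ _ from ⟨ht, hμ⟩)
  · have hdeg : u.degree < N := Polynomial.degree_le_natDegree.trans_lt (by
      exact_mod_cast lt_of_le_of_lt hu (Nat.sub_lt hN one_pos))
    have hlr : {y | y ∈ List.ofFn z} = Set.range z := by
      ext y
      simp [List.mem_ofFn]
    have hSs : (S : Set ℂ) = spectrum ℂ A := A.finite_spectrum.coe_toFinset
    have hfac : (N.factorial : ℝ) ≠ 0 := by exact_mod_cast N.factorial_ne_zero
    -- `Φ` already contains 1/N!, so the bound for the undivided derivative is N! times its maximum;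
    -- the two factorials cancel.
    have hbound := norm_jetSum_foldl_dslope_le S m c (List.ofFn z) h
      (N.factorial * Φ (t₀, μ₀)) (by rwa [hlr, hSs]) (by
        intro p hp
        have hp' : p ∈ convexHull ℝ (insert ((1 : ℝ), (0 : ℂ))
          {q : ℝ × ℂ | q.1 = 0 ∧ q.2 ∈ Set.range z}) := by
          rw [← hlr]
          exact hp
        obtain ⟨ht, μ, hμ, hpμ⟩ := exists_eq_of_mem_convexHull_insert hRne hp'
        have han : ∀ a ∈ S, AnalyticAt ℂ (iteratedDeriv N h) (p.2 + p.1 * a) := fun a ha => by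
          rw [hpμ]
          exact hdK N _ (hmem _ ht μ hμ a ha)
        rw [List.length_ofFn, ← hLjet _ fun a ha =>
          (han a ha).fun_comp (f := fun w => p.2 + (p.1 : ℂ) * w) (by fun_prop),
          D.matrixFun_comp_affine han, hpμ]
        have h1 : Φ (p.1, μ) ≤ Φ (t₀, μ₀) := hmax (show (p.1, μ) ∈ _ from ⟨ht, hμ⟩)
        have h2 := mul_le_mul_of_nonneg_left h1 (Nat.cast_nonneg (α := ℝ) N.factorial)
        refine le_trans (le_of_eq ?_) h2
        simp only [hΦ]
        rw [norm_smul, norm_inv, Complex.norm_natCast, mul_inv_cancel_left₀ hfac])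
    rw [List.length_ofFn, mul_div_cancel_left₀ _ hfac, ← hLjet _ fun a ha =>
      analyticOnNhd_foldl_dslope _ hhK (fun x hx => by
        obtain ⟨k, rfl⟩ : ∃ k, z k = x := by simpa [List.mem_ofFn] using hx
        exact hzK k) a (hSK a ha)] at hbound
    rw [matrixFun_sub_matrixFun_eq A z f (fun a ha => hfK a (subset_convexHull ℝ _ (Or.inl ha)))
      (fun k => hfK _ (hzK k)) u v hdeg hvz hvA hint]
    exact hbound
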